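/- Let $m\ge 1$ be an integer, and let $p_j,q_j$ ($j\in\mathbb Z$) be real numbers with $p_j,q_j\ge 0$, $p_jq_j\neq 0$, $p_j+q_j\le 1$, $p_{j+m}=p_j$ and $q_{j+m}=q_j$ for all $j$; put $r_j=1-p_j-q_j$. Let $\{S_n\}_{n\ge 0}$ be a mod $m$ random walk with these parameters, i.e. a Markov chain on $\mathbb Z$ with an arbitrary initial distribution which from any state $j$ moves to $j+1$, $j-1$, $j$ with probability $p_j$, $q_j$, $r_j$ respectively. Say that the walk is recurrent if almost surely every integer is visited infinitely often, transient toward $+\infty$ if $S_n\to+\infty$ almost surely, and transient toward $-\infty$ if $S_n\to-\infty$ almost surely. Then $\{S_n\}$ is recurrent if and only if $$p_0p_1\cdots p_{m-1}-q_0q_1\cdots q_{m-1}=0,$$ it is transient toward $+\infty$ if and only if this difference is $>0$, and it is transient toward $-\infty$ if and only if it is $<0$. -/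

import Mathlib

open MeasureTheory Filter

/-- `S` is a Markov chain on `ℤ` with (time-homogeneous) transition matrix `P`, under `μ`:
`μ(S₀ = x₀, …, Sₙ = xₙ, Sₙ₊₁ = xₙ₊₁) = μ(S₀ = x₀, …, Sₙ = xₙ) · P(xₙ, xₙ₊₁)`.
The law of `S 0` is arbitrary. -/
structure IsMarkovChain {Ω : Type*} [MeasurableSpace Ω] (μ : Measure Ω)
    (S : ℕ → Ω → ℤ) (P : ℤ → ℤ → ℝ) : Prop where
  measurable : ∀ n, Measurable (S n)
  markov : ∀ (n : ℕ) (x : ℕ → ℤ),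
    μ {ω | ∀ k ≤ n + 1, S k ω = x k} =
      μ {ω | ∀ k ≤ n, S k ω = x k} * ENNReal.ofReal (P (x n) (x (n + 1)))

/-- Nearest-neighbour transition matrix on `ℤ`: from `i`, go up with probability `p i`, down with
probability `q i`, and stay with probability `r i = 1 - p i - q i`. -/
def stepMatrix (p q : ℤ → ℝ) (i j : ℤ) : ℝ :=
  if j = i + 1 then p i
  else if j = i - 1 then q i
  else if j = i then 1 - p i - q i
  else 0

/-- `S` is a mod `m` random walk with transition probabilities `p`, `q` (and `r = 1 - p - q`). -/
structure IsModRandomWalk {Ω : Type*} [MeasurableSpace Ω] (μ : Measure Ω)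
    (m : ℕ) (p q : ℤ → ℝ) (S : ℕ → Ω → ℤ) : Prop where
  p_nonneg : ∀ j, 0 ≤ p j
  q_nonneg : ∀ j, 0 ≤ q j
  add_le_one : ∀ j, p j + q j ≤ 1
  mul_ne_zero : ∀ j, p j * q j ≠ 0
  p_periodic : ∀ j, p (j + m) = p j
  q_periodic : ∀ j, q (j + m) = q j
  isMarkovChain : IsMarkovChain μ S (stepMatrix p q)

/-- The process is recurrent: almost surely, every integer is visited infinitely often. -/
def IsRecurrent {Ω : Type*} [MeasurableSpace Ω] (μ : Measure Ω) (S : ℕ → Ω → ℤ) : Prop :=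
  ∀ᵐ ω ∂μ, ∀ i : ℤ, ∃ᶠ n in atTop, S n ω = i

/-- The process is transient toward `+∞`: almost surely `S n → +∞`
(in particular each state is almost surely visited only finitely often). -/
def IsTransientToPosInf {Ω : Type*} [MeasurableSpace Ω] (μ : Measure Ω) (S : ℕ → Ω → ℤ) : Prop :=
  ∀ᵐ ω ∂μ, Tendsto (fun n => S n ω) atTop atTop

/-- The process is transient toward `-∞`: almost surely `S n → -∞`
(in particular each state is almost surely visited only finitely often). -/
def IsTransientToNegInf {Ω : Type*} [MeasurableSpace Ω] (μ : Measure Ω) (S : ℕ → Ω → ℤ) : Prop :=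
  ∀ᵐ ω ∂μ, Tendsto (fun n => S n ω) atTop atBot

/-! Let `d > 0` solve `p j * d j = q j * d (j - 1)`. A function with increments proportional to `d`
is harmonic, so along the walk it is a martingale. By periodicity `d (j + m) = ρ * d j`, where `ρ`
is the product of the `q`s over that of the `p`s.

If `ρ = 1`, then `d` is periodic, hence bounded and bounded away from `0`. An antidifference `g` of
`d` gives a martingale with bounded increments, which almost surely converges or is unbounded on
both sides. Convergence would freeze the walk, so the walk is unbounded both ways and, having unit
steps, hits every integer infinitely often.

If `ρ ≠ 1`, then `windowSum m d` is positive, strictly monotone or antitone, and has increments `(ρ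
- 1) * d j`. As a positive martingale it converges, which by injectivity prevents infinitely many
visits to any integer, so the walk tends to `+∞` or `-∞`. The function blows up at `+∞` if `ρ > 1`
and at `-∞` if `ρ < 1`, which excludes that end.

The three behaviours are mutually exclusive, so these implications give the equivalences. -/

/-! ### Deterministic nearest-neighbour paths. -/

/-- A nearest-neighbour integer path takes every value between two of its values. -/
theorem exists_eq_of_le_of_le {s : ℕ → ℤ} (hs : ∀ n, |s (n + 1) - s n| ≤ 1) {a b : ℕ} {i : ℤ}
    (hab : a ≤ b) (ha : s a ≤ i) (hb : i ≤ s b) : ∃ n, a ≤ n ∧ n ≤ b ∧ s n = i := by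
  induction b, hab using Nat.le_induction with
  | base => exact ⟨a, le_rfl, le_rfl, le_antisymm ha hb⟩
  | succ b hab ih =>
    by_cases h : i ≤ s b
    · obtain ⟨n, h1, h2, h3⟩ := ih h
      exact ⟨n, h1, by omega, h3⟩
    · have := abs_le.1 (hs b)
      exact ⟨b + 1, by omega, le_rfl, by omega⟩

theorem frequently_le_of_not_bddAbove {s : ℕ → ℤ} (h : ¬ BddAbove (Set.range s)) (i : ℤ) :
    ∃ᶠ n in atTop, i ≤ s n := by
  intro hev
  apply h
  have : IsBoundedUnder (· ≤ ·) atTop s :=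
    isBoundedUnder_of_eventually_le (a := i) (hev.mono fun n hn => (not_le.1 hn).le)
  exact this.bddAbove_range

theorem frequently_ge_of_not_bddBelow {s : ℕ → ℤ} (h : ¬ BddBelow (Set.range s)) (i : ℤ) :
    ∃ᶠ n in atTop, s n ≤ i := by
  intro hev
  apply h
  have : IsBoundedUnder (· ≥ ·) atTop s :=
    isBoundedUnder_of_eventually_ge (a := i) (hev.mono fun n hn => (not_le.1 hn).le)
  exact this.bddBelow_range

/-- A nearest-neighbour integer path unbounded in both directions visits every integer infinitely
often. -/
theorem frequently_eq_of_not_bdd {s : ℕ → ℤ} (hs : ∀ n, |s (n + 1) - s n| ≤ 1)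
    (ha : ¬ BddAbove (Set.range s)) (hb : ¬ BddBelow (Set.range s)) (i : ℤ) :
    ∃ᶠ n in atTop, s n = i := by
  rw [frequently_atTop]
  intro N
  obtain ⟨a, haN, h1⟩ := frequently_atTop.1 (frequently_ge_of_not_bddBelow hb i) N
  obtain ⟨b, hab, h2⟩ := frequently_atTop.1 (frequently_le_of_not_bddAbove ha i) a
  obtain ⟨n, h3, -, h4⟩ := exists_eq_of_le_of_le hs hab h1 h2
  exact ⟨n, haN.trans h3, h4⟩

/-- A nearest-neighbour integer path visiting each integer finitely often tends to `+∞` or to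
`-∞`. -/
theorem tendsto_atTop_or_atBot {s : ℕ → ℤ} (hs : ∀ n, |s (n + 1) - s n| ≤ 1)
    (h : ∀ i, ∀ᶠ n in atTop, s n ≠ i) : Tendsto s atTop atTop ∨ Tendsto s atTop atBot := by
  have hfin : ∀ a b : ℤ, ∀ᶠ n in atTop, s n ∉ Set.Icc a b := by
    intro a b
    have := (eventually_all_finite (Set.finite_Icc a b)).2 fun i _ => h i
    exact this.mono fun n hn hmem => hn _ hmem rfl
  obtain ⟨N, hN⟩ := eventually_atTop.1 (h 0)
  rcases lt_or_gt_of_ne (hN N le_rfl) with h0 | h0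
  · right
    have hneg : ∀ n ≥ N, s n < 0 := by
      intro n hn
      by_contra hcon
      obtain ⟨k, hk, -, hk0⟩ := exists_eq_of_le_of_le hs hn h0.le (not_lt.1 hcon)
      exact hN k hk hk0
    refine tendsto_atBot.2 fun b => ?_
    filter_upwards [hfin b 0, eventually_ge_atTop N] with n h1 h2
    by_contra hcon
    exact h1 ⟨(not_le.1 hcon).le, (hneg n h2).le⟩
  · left
    have hpos : ∀ n ≥ N, 0 < s n := by
      intro n hn
      by_contra hcon
      -- The intermediate value lemma handles upward crossings only, so the path is reflected.
      have hs' : ∀ n, |(-s (n + 1)) - (-s n)| ≤ 1 := by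
        intro n
        rw [← abs_neg]
        convert hs n using 2
        ring
      obtain ⟨k, hk, -, hk0⟩ := exists_eq_of_le_of_le (s := fun n => -s n) (i := 0) hs' hn
        (by simpa using h0.le) (by simpa using hcon)
      exact hN k hk (by simpa using hk0)
    refine tendsto_atTop.2 fun b => ?_
    filter_upwards [hfin 0 b, eventually_ge_atTop N] with n h1 h2
    by_contra hcon
    exact h1 ⟨(hpos n h2).le, (not_le.1 hcon).le⟩

/-- If `g` is injective and `g ∘ s` converges along a nearest-neighbour path that is never
eventually constant, then every integer is visited finitely often. -/
theorem eventually_ne_of_tendsto {s : ℕ → ℤ} (hs : ∀ n, |s (n + 1) - s n| ≤ 1)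
    (hconst : ∀ i, ∃ᶠ n in atTop, s n ≠ i) {g : ℤ → ℝ} (hg : Function.Injective g) {c : ℝ}
    (hc : Tendsto (fun n => g (s n)) atTop (nhds c)) (i : ℤ) : ∀ᶠ n in atTop, s n ≠ i := by
  by_contra hcon
  have hfreq : ∃ᶠ n in atTop, s n = i := by
    simpa [Filter.Frequently] using hcon
  have key : ∀ j, (∃ᶠ n in atTop, s n = j) → g j = c := by
    intro j hj
    by_contra hne
    have := hc.eventually_ne (Ne.symm hne)
    obtain ⟨n, h1, h2⟩ := (hj.and_eventually this).exists
    exact h2 (by rw [h1])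
  -- A path returning to `i` forever without settling there visits a neighbour infinitely often; `g`
  -- would then equal `c` at both points.
  have hleave : ∃ᶠ n in atTop, s n = i - 1 ∨ s n = i + 1 := by
    rw [frequently_atTop]
    intro N
    by_contra! hno
    obtain ⟨a, ha, hai⟩ := frequently_atTop.1 hfreq N
    have hstay : ∀ n ≥ a, s n = i := by
      intro n hn
      induction n, hn using Nat.le_induction with
      | base => exact hai
      | succ n hn ih =>
        have h1 := abs_le.1 (hs n)
        have h2 := hno (n + 1) (by omega)
        omega
    obtain ⟨n, hn, hni⟩ := frequently_atTop.1 (hconst i) a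
    exact hni (hstay n hn)
  have hi := key i hfreq
  rcases frequently_or_distrib.1 hleave with h | h
  · have := hg ((key _ h).trans hi.symm); omega
  · have := hg ((key _ h).trans hi.symm); omega

/-! ### Scale increments, their sums and periodicity. -/

/-- A two-term multiplicative recurrence with positive coefficients has a positive solution
on `ℤ`. -/
theorem exists_pos_int_recurrence {a : ℤ → ℝ} (ha : ∀ j, 0 < a j) :
    ∃ d : ℤ → ℝ, (∀ j, 0 < d j) ∧ ∀ j, d (j + 1) = a (j + 1) * d j := by
  -- Since `toNat` truncates at `0`, at least one of the two products is empty.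
  refine ⟨fun j => (∏ k ∈ Finset.range j.toNat, a (k + 1)) *
    (∏ k ∈ Finset.range (-j).toNat, a (-k))⁻¹, fun j => mul_pos
      (Finset.prod_pos fun _ _ => ha _) (inv_pos.2 (Finset.prod_pos fun _ _ => ha _)), fun j => ?_⟩
  rcases le_or_gt 0 j with hj | hj
  · obtain ⟨n, rfl⟩ := Int.eq_ofNat_of_zero_le hj
    have h1 : ((n : ℤ) + 1).toNat = n + 1 := by omega
    have h2 : (-((n : ℤ) + 1)).toNat = 0 := by omega
    have h3 : (-(n : ℤ)).toNat = 0 := by omega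
    simp only [h1, h2, h3, Int.toNat_natCast, Finset.prod_range_succ]
    ring
  · obtain ⟨n, hn⟩ : ∃ n : ℕ, j = -(n + 1 : ℤ) := ⟨(-j - 1).toNat, by omega⟩
    subst hn
    have h1 : (-((n : ℤ) + 1) + 1).toNat = 0 := by omega
    have h2 : (-(-((n : ℤ) + 1) + 1)).toNat = n := by omega
    have h3 : (-((n : ℤ) + 1)).toNat = 0 := by omega
    have h4 : (- -((n : ℤ) + 1)).toNat = n + 1 := by omega
    have h5 : -((n : ℤ) + 1) + 1 = -n := by ring
    simp only [h1, h2, h3, h4, Finset.prod_range_succ]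
    rw [h5]
    have := (ha (-n)).ne'
    have h6 := (Finset.prod_pos fun k (_ : k ∈ Finset.range n) => ha (-k)).ne'
    field_simp

theorem exists_int_antidifference (d : ℤ → ℝ) : ∃ h : ℤ → ℝ, ∀ j, h (j + 1) - h j = d j := by
  refine ⟨fun j => (∑ k ∈ Finset.range j.toNat, d k) -
    ∑ k ∈ Finset.range (-j).toNat, d (-(k + 1)), fun j => ?_⟩
  rcases le_or_gt 0 j with hj | hj
  · obtain ⟨n, rfl⟩ := Int.eq_ofNat_of_zero_le hj
    have h1 : ((n : ℤ) + 1).toNat = n + 1 := by omega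
    have h2 : (-((n : ℤ) + 1)).toNat = 0 := by omega
    have h3 : (-(n : ℤ)).toNat = 0 := by omega
    simp only [h1, h2, h3, Int.toNat_natCast, Finset.sum_range_succ]
    simp
  · obtain ⟨n, hn⟩ : ∃ n : ℕ, j = -(n + 1 : ℤ) := ⟨(-j - 1).toNat, by omega⟩
    subst hn
    have h1 : (-((n : ℤ) + 1) + 1).toNat = 0 := by omega
    have h2 : (-(-((n : ℤ) + 1) + 1)).toNat = n := by omega
    have h3 : (-((n : ℤ) + 1)).toNat = 0 := by omega
    have h4 : (- -((n : ℤ) + 1)).toNat = n + 1 := by omega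
    simp only [h1, h2, h3, h4, Finset.sum_range_succ]
    simp

/-- Periodicity of `a` makes `d (j + m) / d j` independent of `j`; at `j = 0` it is the product of
`a` over `1, …, m`, that is, over one full period. -/
theorem recurrence_period {m : ℕ} {a d : ℤ → ℝ} (ha : ∀ j, a (j + m) = a j)
    (hd : ∀ j, 0 < d j) (hrec : ∀ j, d (j + 1) = a (j + 1) * d j) (j : ℤ) :
    d (j + m) = (∏ i ∈ Finset.range m, a i) * d j := by
  have hshift : ∀ n : ℕ, d n = (∏ k ∈ Finset.range n, a (k + 1)) * d 0 := by
    intro n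
    induction n with
    | zero => simp
    | succ n ih =>
      rw [Finset.prod_range_succ, Nat.cast_succ, hrec, ih]
      ring
  have hprod : ∏ k ∈ Finset.range m, a (k + 1) = ∏ i ∈ Finset.range m, a i := by
    cases m with
    | zero => simp
    | succ n =>
      rw [Finset.prod_range_succ, Finset.prod_range_succ']
      have := ha 0
      push_cast at this ⊢
      rw [← this, zero_add]
  have hstep : ∀ j, d (j + 1 + m) / d (j + 1) = d (j + m) / d j := by
    intro j
    have h1 := hrec (j + m)
    have h2 : a (j + m + 1) = a (j + 1) := by rw [← ha (j + 1)]; congr 1; ring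
    have h3 : j + 1 + (m : ℤ) = j + m + 1 := by ring
    have h4 : a (j + 1) ≠ 0 := by
      intro h0
      have := hrec j
      rw [h0, zero_mul] at this
      exact (hd _).ne' this
    rw [h3, h1, hrec j, h2, mul_div_mul_left _ _ h4]
  have hall : ∀ j, d (j + m) / d j = d m / d 0 := by
    intro j
    induction j using Int.induction_on with
    | zero => simp
    | succ i ih => rw [hstep, ih]
    | pred i ih =>
      have := hstep (-(i : ℤ) - 1)
      rw [sub_add_cancel] at this
      rw [← this, ih]
  have := hall j
  rw [hshift m, hprod, mul_div_cancel_right₀ _ (hd 0).ne'] at this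
  rw [← this, div_mul_cancel₀ _ (hd j).ne']

/-- Sum over a window of length `m`. -/
noncomputable def windowSum (m : ℕ) (d : ℤ → ℝ) (j : ℤ) : ℝ := ∑ k ∈ Finset.range m, d (j + k)

theorem windowSum_pos {m : ℕ} (hm : 1 ≤ m) {d : ℤ → ℝ} (hd : ∀ j, 0 < d j) (j : ℤ) :
    0 < windowSum m d j :=
  Finset.sum_pos (fun _ _ => hd _) ⟨0, by simp; omega⟩

theorem windowSum_succ_sub (m : ℕ) (d : ℤ → ℝ) (j : ℤ) :
    windowSum m d (j + 1) - windowSum m d j = d (j + m) - d j := by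
  have h := (Finset.sum_range_succ (fun k : ℕ => d (j + k)) m).symm.trans
    (Finset.sum_range_succ' (fun k : ℕ => d (j + k)) m)
  have h2 : ∀ k : ℕ, j + ((k + 1 : ℕ) : ℤ) = j + 1 + k := by intro k; push_cast; ring
  simp only [h2, Nat.cast_zero, add_zero] at h
  unfold windowSum
  linarith

theorem windowSum_add_period {m : ℕ} {d : ℤ → ℝ} {ρ : ℝ} (h : ∀ j, d (j + m) = ρ * d j) (j : ℤ) :
    windowSum m d (j + m) = ρ * windowSum m d j := by
  unfold windowSum
  rw [Finset.mul_sum]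
  refine Finset.sum_congr rfl fun k _ => ?_
  rw [← h]
  congr 1
  ring

theorem exists_bounds_of_periodic {m : ℕ} (hm : 1 ≤ m) {d : ℤ → ℝ} (hd : ∀ j, 0 < d j)
    (hper : ∀ j, d (j + m) = d j) : ∃ δ R : ℝ, 0 < δ ∧ ∀ j, δ ≤ d j ∧ d j ≤ R := by
  have hP : Function.Periodic d (m : ℤ) := hper
  have hne : (Finset.Ico (0 : ℤ) m).Nonempty := ⟨0, by simp; omega⟩
  obtain ⟨a, -, ha⟩ := Finset.exists_min_image _ d hne
  obtain ⟨b, -, hb⟩ := Finset.exists_max_image _ d hne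
  refine ⟨d a, d b, hd a, fun j => ?_⟩
  obtain ⟨y, hy, hjy⟩ := hP.exists_mem_Ico₀ (by omega) j
  rw [hjy]
  exact ⟨ha y (by simpa using hy), hb y (by simpa using hy)⟩

/-- A monotone function on `ℤ` that gets multiplied by `ρ > 1` over each period tends to `+∞`. -/
theorem tendsto_atTop_of_period_mul {m : ℕ} {g : ℤ → ℝ} (hg : Monotone g) {ρ : ℝ} (hρ : 1 < ρ)
    (h0 : 0 < g 0) (h : ∀ j, g (j + m) = ρ * g j) : Tendsto g atTop atTop := by
  have hpow : ∀ n : ℕ, g (n * m : ℤ) = ρ ^ n * g 0 := by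
    intro n
    induction n with
    | zero => simp
    | succ n ih =>
      have : (((n + 1 : ℕ) : ℤ) * m) = n * m + m := by push_cast; ring
      rw [this, h, ih]
      ring
  refine tendsto_atTop_atTop_of_monotone hg fun b => ?_
  obtain ⟨n, hn⟩ := pow_unbounded_of_one_lt (b / g 0) hρ
  exact ⟨n * m, by rw [hpow]; exact ((div_lt_iff₀ h0).1 hn).le⟩

/-! ### Cylinder events and general Markov chains. -/

section MarkovChain

variable {Ω : Type*} {S : ℕ → Ω → ℤ}

/-- The event that the path follows `x` up to time `n`. -/
def cylinderEvent (S : ℕ → Ω → ℤ) (n : ℕ) (x : ℕ → ℤ) : Set Ω := {ω | ∀ k ≤ n, S k ω = x k}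

/-- The path up to time `n`. -/
def pathUpTo (S : ℕ → Ω → ℤ) (n : ℕ) (ω : Ω) : Fin (n + 1) → ℤ := fun k => S k ω

/-- Extend a finite path by `0`. -/
def extendPath {n : ℕ} (y : Fin (n + 1) → ℤ) (k : ℕ) : ℤ :=
  if h : k < n + 1 then y ⟨k, h⟩ else 0

theorem pathUpTo_preimage_singleton (n : ℕ) (y : Fin (n + 1) → ℤ) :
    pathUpTo S n ⁻¹' {y} = cylinderEvent S n (extendPath y) := by
  ext ω
  simp only [Set.mem_preimage, Set.mem_singleton_iff, funext_iff, pathUpTo, cylinderEvent,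
    Set.mem_ofPred_eq, extendPath]
  constructor
  · intro h k hk
    have hk' : k < n + 1 := by omega
    rw [dif_pos hk']
    exact h ⟨k, hk'⟩
  · intro h k
    have := h k (by omega)
    rwa [dif_pos k.2] at this

variable [MeasurableSpace Ω] {μ : Measure Ω}

theorem measurableSet_cylinderEvent (hS : ∀ n, Measurable (S n)) (n : ℕ) (x : ℕ → ℤ) :
    MeasurableSet (cylinderEvent S n x) := by
  have : cylinderEvent S n x = ⋂ k, ⋂ (_ : k ≤ n), S k ⁻¹' {x k} := by
    ext; simp [cylinderEvent]
  rw [this]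
  exact .iInter fun k => .iInter fun _ => hS k (measurableSet_singleton _)

theorem measurable_pathUpTo (hS : ∀ n, Measurable (S n)) (n : ℕ) : Measurable (pathUpTo S n) :=
  measurable_pi_lambda _ fun k => hS k

/-- There are only countably many paths up to time `n`. -/
theorem ae_of_forall_cylinderEvent (n : ℕ) {φ : Ω → Prop}
    (h : ∀ x, ∀ᵐ ω ∂μ, ω ∈ cylinderEvent S n x → φ ω) : ∀ᵐ ω ∂μ, φ ω := by
  have h' : ∀ᵐ ω ∂μ, ∀ y : Fin (n + 1) → ℤ, ω ∈ cylinderEvent S n (extendPath y) → φ ω :=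
    ae_all_iff.2 fun y => h _
  filter_upwards [h'] with ω hω
  refine hω (pathUpTo S n ω) ?_
  rw [← pathUpTo_preimage_singleton]
  rfl

namespace IsMarkovChain

variable {P : ℤ → ℤ → ℝ}

theorem measure_cylinderEvent_inter (hC : IsMarkovChain μ S P) (n : ℕ) (x : ℕ → ℤ) (j : ℤ) :
    μ (cylinderEvent S n x ∩ {ω | S (n + 1) ω = j}) =
      μ (cylinderEvent S n x) * ENNReal.ofReal (P (x n) j) := by
  have h := hC.markov n (Function.update x (n + 1) j)
  have h1 : {ω | ∀ k ≤ n + 1, S k ω = Function.update x (n + 1) j k} =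
      cylinderEvent S n x ∩ {ω | S (n + 1) ω = j} := by
    ext ω
    simp only [Set.mem_ofPred_eq, Set.mem_inter_iff, cylinderEvent]
    constructor
    · intro h
      refine ⟨fun k hk => ?_, ?_⟩
      · have := h k (by omega)
        rwa [Function.update_of_ne (by omega)] at this
      · simpa using h (n + 1) le_rfl
    · rintro ⟨h2, h3⟩ k hk
      rcases Nat.lt_or_ge n k with hk' | hk'
      · obtain rfl : k = n + 1 := by omega
        simpa using h3
      · rw [Function.update_of_ne (by omega)]
        exact h2 k hk'
  have h2 : {ω | ∀ k ≤ n, S k ω = Function.update x (n + 1) j k} = cylinderEvent S n x := by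
    ext ω
    simp only [Set.mem_ofPred_eq, cylinderEvent]
    refine forall₂_congr fun k hk => ?_
    rw [Function.update_of_ne (by omega)]
  rw [h1, h2, Function.update_self, Function.update_of_ne (by omega)] at h
  exact h

/-- Under an arbitrary initial law `g (S n)` may fail to be integrable; fixing the start cures this.
The Markov property survives because each cylinder lies inside the starting event or is disjoint
from it. -/
theorem restrict_start (hC : IsMarkovChain μ S P) (x₀ : ℤ) :
    IsMarkovChain (μ.restrict {ω | S 0 ω = x₀}) S P := by
  have hm : MeasurableSet {ω | S 0 ω = x₀} := hC.measurable 0 (measurableSet_singleton x₀)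
  refine ⟨hC.measurable, fun n x => ?_⟩
  rw [Measure.restrict_apply' hm, Measure.restrict_apply' hm]
  by_cases hx : x 0 = x₀
  · rw [Set.inter_eq_left.2, Set.inter_eq_left.2]
    · exact hC.markov n x
    · exact fun ω hω => (hω 0 (Nat.zero_le _)).trans hx
    · exact fun ω hω => (hω 0 (Nat.zero_le _)).trans hx
  · have : ∀ n, {ω | ∀ k ≤ n, S k ω = x k} ∩ {ω | S 0 ω = x₀} = ∅ := by
      intro n
      ext ω
      simp only [Set.mem_inter_iff, Set.mem_ofPred_eq, Set.mem_empty_iff_false, iff_false, not_and]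
      exact fun h h0 => hx ((h 0 (Nat.zero_le _)).symm.trans h0)
    simp [this]

/-- A state with positive probability of being left is almost surely not absorbing. -/
theorem ae_frequently_ne [IsFiniteMeasure μ] (hC : IsMarkovChain μ S P) {i : ℤ} (hi : P i i < 1) :
    ∀ᵐ ω ∂μ, ∃ᶠ n in atTop, S n ω ≠ i := by
  have key : ∀ N : ℕ, ∀ᵐ ω ∂μ, ¬ ∀ n > N, S n ω = i := by
    intro N
    refine ae_of_forall_cylinderEvent (S := S) N fun x => ?_
    set r := ENNReal.ofReal (P i i)
    have hr : r < 1 := by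
      rw [← ENNReal.ofReal_one]
      exact (ENNReal.ofReal_lt_ofReal_iff one_pos).2 hi
    -- Follow `x` up to time `N`, then sit at `i`. Counting starts at `N + 1`, the first time `z` is
    -- known to be at `i`; each later step costs a factor `r < 1`.
    set z : ℕ → ℤ := fun k => if k ≤ N then x k else i with hz
    have hbound : ∀ l : ℕ, μ (cylinderEvent S (N + 1 + l) z) ≤ r ^ l * μ Set.univ := by
      intro l
      induction l with
      | zero => simpa using measure_mono (Set.subset_univ _)
      | succ l ih =>
        have h := hC.markov (N + 1 + l) z
        have h1 : z (N + 1 + l) = i := if_neg (by omega)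
        have h2 : z (N + 1 + l + 1) = i := if_neg (by omega)
        rw [h1, h2] at h
        calc μ (cylinderEvent S (N + 1 + (l + 1)) z)
            = μ (cylinderEvent S (N + 1 + l) z) * r := h
          _ ≤ r ^ l * μ Set.univ * r := by gcongr
          _ = r ^ (l + 1) * μ Set.univ := by ring
    have hlim : Tendsto (fun l : ℕ => r ^ l * μ Set.univ) atTop (nhds 0) := by
      have := ENNReal.Tendsto.mul_const (ENNReal.tendsto_pow_atTop_nhds_zero_of_lt_one hr)
        (Or.inr (measure_ne_top μ Set.univ))
      simpa using this
    rw [ae_iff]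
    refine le_antisymm (ge_of_tendsto' hlim fun l => (measure_mono ?_).trans (hbound l)) zero_le
    intro ω hω k _
    simp only [Set.mem_ofPred_eq, Classical.not_imp, not_not] at hω
    by_cases hk : k ≤ N
    · simp only [hz, if_pos hk]; exact hω.1 k hk
    · simp only [hz, if_neg hk]; exact hω.2 k (by omega)
  filter_upwards [ae_all_iff.2 key] with ω hω
  rw [frequently_atTop]
  intro N
  have := hω N
  push Not at this
  obtain ⟨n, h1, h2⟩ := this
  exact ⟨n, h1.le, h2⟩

/-! ### Harmonic functions of nearest-neighbour chains as martingales. -/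

variable {p q : ℤ → ℝ}

theorem ae_abs_step_le_one (hC : IsMarkovChain μ S (stepMatrix p q)) :
    ∀ᵐ ω ∂μ, ∀ n, |S (n + 1) ω - S n ω| ≤ 1 := by
  refine ae_all_iff.2 fun n => ae_of_forall_cylinderEvent (S := S) n fun x => ?_
  have h : ∀ j : ℤ, ∀ᵐ ω ∂μ, 1 < |j - x n| →
      ω ∉ cylinderEvent S n x ∩ {ω | S (n + 1) ω = j} := by
    intro j
    by_cases hj : 1 < |j - x n|
    · have h0 : μ (cylinderEvent S n x ∩ {ω | S (n + 1) ω = j}) = 0 := by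
        rw [hC.measure_cylinderEvent_inter]
        have : stepMatrix p q (x n) j = 0 := by
          unfold stepMatrix
          rw [if_neg, if_neg, if_neg] <;> rintro rfl <;> simp at hj
        simp [this]
      filter_upwards [measure_eq_zero_iff_ae_notMem.1 h0] with ω hω _ using hω
    · exact ae_of_all _ fun ω h => absurd h hj
  filter_upwards [ae_all_iff.2 h] with ω hω hcyl
  by_contra hcon
  refine hω (S (n + 1) ω) ?_ ⟨hcyl, rfl⟩
  rw [← hcyl n le_rfl]
  exact not_le.1 hcon

/-- The filtration generated by the path. -/
def pathFiltration (hS : ∀ n, Measurable (S n)) : Filtration ℕ ‹MeasurableSpace Ω› where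
  seq n := MeasurableSpace.comap (pathUpTo S n) inferInstance
  mono' := by
    intro a b hab
    rw [← measurable_iff_comap_le]
    have : pathUpTo S a = (fun y (k : Fin (a + 1)) => y ⟨k, by omega⟩) ∘ pathUpTo S b := rfl
    rw [this]
    exact (measurable_pi_lambda _ fun k => measurable_pi_apply _).comp (comap_measurable _)
  le' n := (measurable_pathUpTo hS n).comap_le

theorem stronglyAdapted_comp (hS : ∀ n, Measurable (S n)) (g : ℤ → ℝ) :
    StronglyAdapted (pathFiltration hS) (fun n ω => g (S n ω)) := by
  intro n
  have : (fun ω => g (S n ω)) = (fun y : Fin (n + 1) → ℤ => g (y (Fin.last n))) ∘ pathUpTo S n := by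
    ext ω; simp [pathUpTo]
  change StronglyMeasurable[pathFiltration hS n] (fun ω => g (S n ω))
  rw [this]
  exact ((measurable_of_countable _).comp (comap_measurable _)).stronglyMeasurable

theorem integrable_comp [IsFiniteMeasure μ] (hC : IsMarkovChain μ S (stepMatrix p q)) {x₀ : ℤ}
    (h0 : ∀ᵐ ω ∂μ, S 0 ω = x₀) (g : ℤ → ℝ) (n : ℕ) : Integrable (fun ω => g (S n ω)) μ := by
  have hmem : ∀ᵐ ω ∂μ, S n ω ∈ Finset.Icc (x₀ - n) (x₀ + n) := by
    filter_upwards [h0, hC.ae_abs_step_le_one] with ω h1 h2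
    rw [Finset.mem_Icc]
    clear * - h1 h2
    induction n with
    | zero => simp [h1]
    | succ n ih =>
      have := abs_le.1 (h2 n)
      push_cast
      omega
  refine Integrable.of_bound (C := ∑ j ∈ Finset.Icc (x₀ - n) (x₀ + n), ‖g j‖)
    ((measurable_of_countable g).comp (hC.measurable n)).aestronglyMeasurable ?_
  filter_upwards [hmem] with ω hω
  exact Finset.single_le_sum (f := fun j => ‖g j‖) (fun _ _ => norm_nonneg _) hω

/-- A harmonic function of the chain is a martingale. -/
theorem martingale_comp [IsFiniteMeasure μ] (hC : IsMarkovChain μ S (stepMatrix p q))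
    (hp : ∀ j, 0 ≤ p j) (hq : ∀ j, 0 ≤ q j) {g : ℤ → ℝ}
    (hg : ∀ j, p j * (g (j + 1) - g j) + q j * (g (j - 1) - g j) = 0)
    (hint : ∀ n, Integrable (fun ω => g (S n ω)) μ) :
    Martingale (fun n ω => g (S n ω)) (pathFiltration hC.measurable) μ := by
  refine martingale_of_setIntegral_eq_succ (stronglyAdapted_comp _ g) hint fun n s hs => ?_
  have hD : Integrable (fun ω => g (S (n + 1) ω) - g (S n ω)) μ := (hint (n + 1)).sub (hint n)
  -- Every event of the filtration at time `n` is a countable disjoint union of cylinders, so one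
  -- cylinder suffices. There a holding step contributes nothing, leaving the up and down terms that
  -- harmonicity cancels.
  have hsingle : ∀ x : ℕ → ℤ, ∫ ω in cylinderEvent S n x, (g (S (n + 1) ω) - g (S n ω)) ∂μ = 0 := by
    intro x
    have hcm := measurableSet_cylinderEvent hC.measurable n x
    have hjm : ∀ j : ℤ, MeasurableSet {ω | S (n + 1) ω = j} := fun j =>
      hC.measurable (n + 1) (measurableSet_singleton j)
    have hcongr : ∀ᵐ ω ∂μ, ω ∈ cylinderEvent S n x → g (S (n + 1) ω) - g (S n ω) =
        {ω | S (n + 1) ω = x n + 1}.indicator (fun _ => g (x n + 1) - g (x n)) ω +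
        {ω | S (n + 1) ω = x n - 1}.indicator (fun _ => g (x n - 1) - g (x n)) ω := by
      filter_upwards [hC.ae_abs_step_le_one] with ω hω hcyl
      have h1 := abs_le.1 (hω n)
      have hxn : S n ω = x n := hcyl n le_rfl
      rw [hxn] at h1 ⊢
      have : S (n + 1) ω = x n + 1 ∨ S (n + 1) ω = x n - 1 ∨ S (n + 1) ω = x n := by omega
      simp only [Set.indicator_apply, Set.mem_ofPred_eq]
      rcases this with h | h | h
      · rw [if_pos h, if_neg (by omega), h, add_zero]
      · rw [if_pos h, if_neg (by omega), h, zero_add]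
      · rw [if_neg (by omega), if_neg (by omega), h]; simp
    have hval : ∀ (j : ℤ) (c : ℝ), 0 ≤ stepMatrix p q (x n) j →
        ∫ ω in cylinderEvent S n x, {ω | S (n + 1) ω = j}.indicator (fun _ => c) ω ∂μ =
          μ.real (cylinderEvent S n x) * stepMatrix p q (x n) j * c := by
      intro j c hj
      rw [setIntegral_indicator (hjm j), setIntegral_const, measureReal_def,
        hC.measure_cylinderEvent_inter, ENNReal.toReal_mul, ENNReal.toReal_ofReal hj, smul_eq_mul]
      rfl
    have hup : stepMatrix p q (x n) (x n + 1) = p (x n) := by simp [stepMatrix]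
    have hdown : stepMatrix p q (x n) (x n - 1) = q (x n) := by
      unfold stepMatrix
      rw [if_neg (by omega), if_pos rfl]
    rw [setIntegral_congr_ae hcm hcongr, integral_add
      ((integrable_const _).indicator (hjm _)) ((integrable_const _).indicator (hjm _)),
      hval _ _ (by rw [hup]; exact hp _), hval _ _ (by rw [hdown]; exact hq _), hup, hdown]
    linear_combination μ.real (cylinderEvent S n x) * hg (x n)
  have hzero : ∫ ω in s, (g (S (n + 1) ω) - g (S n ω)) ∂μ = 0 := by
    obtain ⟨B, -, rfl⟩ := hs
    have hunion : pathUpTo S n ⁻¹' B = ⋃ y : B, pathUpTo S n ⁻¹' {(y : Fin (n + 1) → ℤ)} := by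
      ext ω; simp
    have hsum := hasSum_integral_iUnion (μ := μ)
      (s := fun y : B => pathUpTo S n ⁻¹' {(y : Fin (n + 1) → ℤ)})
      (f := fun ω => g (S (n + 1) ω) - g (S n ω))
      (fun y => measurable_pathUpTo hC.measurable n (measurableSet_singleton _))
      (fun y z hyz => Disjoint.preimage _ (by simpa [Subtype.ext_iff] using hyz))
      hD.integrableOn
    simp only [pathUpTo_preimage_singleton, hsingle] at hsum
    rw [hunion]
    simp only [pathUpTo_preimage_singleton]
    exact hsum.unique hasSum_zero
  rw [integral_sub (hint (n + 1)).integrableOn (hint n).integrableOn, sub_eq_zero] at hzero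
  exact hzero.symm

theorem ae_of_forall_restrict_start {φ : Ω → Prop} (hS : Measurable (S 0))
    (h : ∀ x₀, ∀ᵐ ω ∂μ.restrict {ω | S 0 ω = x₀}, φ ω) : ∀ᵐ ω ∂μ, φ ω := by
  have h' : ∀ᵐ ω ∂μ, ∀ x₀, S 0 ω = x₀ → φ ω := ae_all_iff.2 fun x₀ =>
    (ae_restrict_iff' (hS (measurableSet_singleton x₀))).1 (h x₀)
  filter_upwards [h'] with ω hω using hω _ rfl

/-- A nonnegative harmonic function converges along the chain. -/
theorem ae_tendsto_comp_of_nonneg [IsFiniteMeasure μ] (hC : IsMarkovChain μ S (stepMatrix p q))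
    (hp : ∀ j, 0 ≤ p j) (hq : ∀ j, 0 ≤ q j) {g : ℤ → ℝ}
    (hg : ∀ j, p j * (g (j + 1) - g j) + q j * (g (j - 1) - g j) = 0) (hpos : ∀ j, 0 ≤ g j) :
    ∀ᵐ ω ∂μ, ∃ c, Tendsto (fun n => g (S n ω)) atTop (nhds c) := by
  refine ae_of_forall_restrict_start (hC.measurable 0) fun x₀ => ?_
  have hC' := hC.restrict_start x₀
  have hint := hC'.integrable_comp
    (ae_restrict_mem (hC.measurable 0 (measurableSet_singleton x₀))) g
  have hM := hC'.martingale_comp hp hq hg hint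
  -- By nonnegativity the `L¹` norm is the integral, which is constant in `n` for a martingale.
  refine hM.submartingale.exists_ae_tendsto_of_bdd
    (R := (∫ ω in {ω | S 0 ω = x₀}, g (S 0 ω) ∂μ).toNNReal) fun n => ?_
  rw [eLpNorm_one_eq_lintegral_enorm]
  have h1 : ∀ ω, ‖g (S n ω)‖ₑ = ENNReal.ofReal (g (S n ω)) := fun ω =>
    Real.enorm_of_nonneg (hpos _)
  simp_rw [h1]
  rw [← ofReal_integral_eq_lintegral_ofReal (hint n) (ae_of_all _ fun ω => hpos _)]
  have h2 := hM.setIntegral_eq (Nat.zero_le n) MeasurableSet.univ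
  simp only [setIntegral_univ] at h2
  rw [← h2]
  rfl

/-- A harmonic function with bounded increments either converges along the chain or is unbounded
in both directions. -/
theorem ae_tendsto_or_not_bdd [IsFiniteMeasure μ] (hC : IsMarkovChain μ S (stepMatrix p q))
    (hp : ∀ j, 0 ≤ p j) (hq : ∀ j, 0 ≤ q j) {g : ℤ → ℝ}
    (hg : ∀ j, p j * (g (j + 1) - g j) + q j * (g (j - 1) - g j) = 0) {R : ℝ}
    (hR : ∀ j, |g (j + 1) - g j| ≤ R) :
    ∀ᵐ ω ∂μ, (∃ c, Tendsto (fun n => g (S n ω)) atTop (nhds c)) ∨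
      (¬ BddAbove (Set.range fun n => g (S n ω)) ∧ ¬ BddBelow (Set.range fun n => g (S n ω))) := by
  refine ae_of_forall_restrict_start (hC.measurable 0) fun x₀ => ?_
  have hC' := hC.restrict_start x₀
  have hint := hC'.integrable_comp
    (ae_restrict_mem (hC.measurable 0 (measurableSet_singleton x₀))) g
  have hM := hC'.martingale_comp hp hq hg hint
  have hR0 : 0 ≤ R := (abs_nonneg _).trans (hR 0)
  have hbdd : ∀ᵐ ω ∂μ.restrict {ω | S 0 ω = x₀}, ∀ n,
      |g (S (n + 1) ω) - g (S n ω)| ≤ (⟨R, hR0⟩ : NNReal) := by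
    filter_upwards [hC'.ae_abs_step_le_one] with ω hω n
    have h1 := abs_le.1 (hω n)
    have : S (n + 1) ω = S n ω + 1 ∨ S n ω = S (n + 1) ω + 1 ∨ S (n + 1) ω = S n ω := by omega
    rcases this with h | h | h
    · rw [h]; exact hR _
    · rw [h, abs_sub_comm]; exact hR _
    · rw [h]; simpa using hR0
  filter_upwards [hM.submartingale.bddAbove_iff_exists_tendsto hbdd,
    hM.bddAbove_range_iff_bddBelow_range hbdd] with ω h1 h2
  by_cases h : BddAbove (Set.range fun n => g (S n ω))
  · exact Or.inl (h1.1 h)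
  · exact Or.inr ⟨h, fun h' => h (h2.2 h')⟩

end IsMarkovChain

end MarkovChain

/-! ### The mod `m` walk: critical and transient cases. -/

namespace IsModRandomWalk

variable {Ω : Type*} [MeasurableSpace Ω] {μ : Measure Ω} {m : ℕ} {p q : ℤ → ℝ} {S : ℕ → Ω → ℤ}

theorem p_pos (hS : IsModRandomWalk μ m p q S) (j : ℤ) : 0 < p j :=
  (hS.p_nonneg j).lt_of_ne' (left_ne_zero_of_mul (hS.mul_ne_zero j))

theorem q_pos (hS : IsModRandomWalk μ m p q S) (j : ℤ) : 0 < q j :=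
  (hS.q_nonneg j).lt_of_ne' (right_ne_zero_of_mul (hS.mul_ne_zero j))

/-- The increments of the scale function of the walk, and their behaviour under a shift by one
period. -/
theorem exists_scale_increment (hS : IsModRandomWalk μ m p q S) :
    ∃ d : ℤ → ℝ, (∀ j, 0 < d j) ∧ (∀ j, p j * d j = q j * d (j - 1)) ∧
      ∀ j, d (j + m) = (∏ i ∈ Finset.range m, q (i : ℤ)) / (∏ i ∈ Finset.range m, p (i : ℤ)) *
        d j := by
  obtain ⟨d, hd, hrec⟩ := exists_pos_int_recurrence (a := fun j => q j / p j)
    fun j => div_pos (hS.q_pos j) (hS.p_pos j)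
  refine ⟨d, hd, fun j => ?_, fun j => ?_⟩
  · have h := hrec (j - 1)
    simp only [sub_add_cancel] at h
    have := (hS.p_pos j).ne'
    rw [h]
    field_simp
  · rw [recurrence_period (a := fun j => q j / p j)
      (fun j => by simp only [hS.p_periodic, hS.q_periodic]) hd hrec, Finset.prod_div_distrib]

/-- Used with `c = 1` in the critical case and with `c = ρ - 1` for the window sum. -/
theorem harmonic_of_increment {d g : ℤ → ℝ} (hd : ∀ j, p j * d j = q j * d (j - 1)) {c : ℝ}
    (hg : ∀ j, g (j + 1) - g j = c * d j) (j : ℤ) :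
    p j * (g (j + 1) - g j) + q j * (g (j - 1) - g j) = 0 := by
  have h := hg (j - 1)
  rw [sub_add_cancel] at h
  linear_combination p j * hg j - q j * h + c * hd j

theorem ae_frequently_ne [IsFiniteMeasure μ] (hS : IsModRandomWalk μ m p q S) :
    ∀ᵐ ω ∂μ, ∀ i, ∃ᶠ n in atTop, S n ω ≠ i := by
  refine ae_all_iff.2 fun i => hS.isMarkovChain.ae_frequently_ne ?_
  have h1 := hS.p_pos i
  have h2 := hS.q_pos i
  have : stepMatrix p q i i = 1 - p i - q i := by
    unfold stepMatrix
    rw [if_neg (by omega), if_neg (by omega), if_pos rfl]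
  linarith

theorem isRecurrent_of_prod_eq [IsFiniteMeasure μ] (hm : 1 ≤ m) (hS : IsModRandomWalk μ m p q S)
    (h : ∏ i ∈ Finset.range m, p (i : ℤ) = ∏ i ∈ Finset.range m, q (i : ℤ)) :
    IsRecurrent μ S := by
  obtain ⟨d, hd, hpq, hper⟩ := hS.exists_scale_increment
  have hQ : ∏ i ∈ Finset.range m, q (i : ℤ) ≠ 0 := Finset.prod_ne_zero_iff.2 fun i _ => (hS.q_pos i).ne'
  simp only [h, div_self hQ, one_mul] at hper
  obtain ⟨δ, R, hδ, hb⟩ := exists_bounds_of_periodic hm hd hper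
  obtain ⟨g, hg⟩ := exists_int_antidifference d
  have hharm := harmonic_of_increment (c := 1) hpq (by simpa using hg)
  have hmono : Monotone g := monotone_int_of_le_succ fun j => by linarith [hg j, hd j]
  filter_upwards [hS.isMarkovChain.ae_tendsto_or_not_bdd hS.p_nonneg hS.q_nonneg hharm
    (R := R) (fun j => by rw [hg, abs_of_pos (hd j)]; exact (hb j).2),
    hS.isMarkovChain.ae_abs_step_le_one, hS.ae_frequently_ne] with ω h1 h2 h3
  rcases h1 with ⟨c, hc⟩ | ⟨ha, hb'⟩
  · exfalso
    -- Every actual move changes `g` by at least `δ`, so vanishing increments force the walk to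
    -- stop.
    have hdiff : Tendsto (fun n => g (S (n + 1) ω) - g (S n ω)) atTop (nhds 0) := by
      simpa using (hc.comp (tendsto_add_atTop_nat 1)).sub hc
    obtain ⟨N, hN⟩ := eventually_atTop.1
      ((Metric.tendsto_nhds.1 hdiff δ hδ).mono fun n hn => by simpa using hn)
    have hstay : ∀ n ≥ N, S n ω = S N ω := by
      intro n hn
      induction n, hn using Nat.le_induction with
      | base => rfl
      | succ n hn ih =>
        have h4 := abs_le.1 (h2 n)
        have h5 := abs_lt.1 (hN n hn)
        have : S (n + 1) ω = S n ω + 1 ∨ S n ω = S (n + 1) ω + 1 ∨ S (n + 1) ω = S n ω := by omega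
        rcases this with h | h | h
        · rw [h] at h5; linarith [hg (S n ω), (hb (S n ω)).1]
        · rw [h] at h5; linarith [hg (S (n + 1) ω), (hb (S (n + 1) ω)).1]
        · rw [h, ih]
    obtain ⟨n, hn, hne⟩ := frequently_atTop.1 (h3 (S N ω)) N
    exact hne (hstay n hn)
  · refine frequently_eq_of_not_bdd h2 (fun hB => ha ?_) (fun hB => hb' ?_)
    · simpa [← Set.range_comp, Function.comp_def] using hmono.map_bddAbove hB
    · simpa [← Set.range_comp, Function.comp_def] using hmono.map_bddBelow hB

/-- Off the critical case there is a positive monotone or antitone harmonic function that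
converges along the walk, and the walk tends to `+∞` or to `-∞`. -/
theorem ae_transient_of_prod_ne [IsFiniteMeasure μ] (hm : 1 ≤ m) (hS : IsModRandomWalk μ m p q S)
    (h : ∏ i ∈ Finset.range m, p (i : ℤ) ≠ ∏ i ∈ Finset.range m, q (i : ℤ)) :
    ∃ g : ℤ → ℝ, (∀ j, 0 < g j) ∧
      (∀ j, g (j + m) = (∏ i ∈ Finset.range m, q (i : ℤ)) / (∏ i ∈ Finset.range m, p (i : ℤ)) *
        g j) ∧
      (∏ i ∈ Finset.range m, p (i : ℤ) < ∏ i ∈ Finset.range m, q (i : ℤ) → Monotone g) ∧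
      (∏ i ∈ Finset.range m, q (i : ℤ) < ∏ i ∈ Finset.range m, p (i : ℤ) → Antitone g) ∧
      ∀ᵐ ω ∂μ, (∃ c, Tendsto (fun n => g (S n ω)) atTop (nhds c)) ∧
        (Tendsto (fun n => S n ω) atTop atTop ∨ Tendsto (fun n => S n ω) atTop atBot) := by
  obtain ⟨d, hd, hpq, hper⟩ := hS.exists_scale_increment
  have hP : 0 < ∏ i ∈ Finset.range m, p (i : ℤ) := Finset.prod_pos fun i _ => hS.p_pos i
  set ρ := (∏ i ∈ Finset.range m, q (i : ℤ)) / (∏ i ∈ Finset.range m, p (i : ℤ)) with hρ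
  have hinc : ∀ j, windowSum m d (j + 1) - windowSum m d j = (ρ - 1) * d j := fun j => by
    rw [windowSum_succ_sub, hper]; ring
  have hharm := harmonic_of_increment hpq hinc
  have hup : 1 < ρ → StrictMono (windowSum m d) := fun h1 => strictMono_int_of_lt_succ fun j => by
    have := mul_pos (sub_pos.2 h1) (hd j)
    linarith [hinc j]
  have hdown : ρ < 1 → StrictAnti (windowSum m d) := fun h1 => strictAnti_int_of_succ_lt fun j => by
    have := mul_pos (sub_pos.2 h1) (hd j)
    linarith [hinc j]
  have hinj : Function.Injective (windowSum m d) := by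
    rcases lt_or_gt_of_ne h with h1 | h1
    · exact (hup ((one_lt_div hP).2 h1)).injective
    · exact (hdown ((div_lt_one hP).2 h1)).injective
  refine ⟨windowSum m d, windowSum_pos hm hd, windowSum_add_period hper,
    fun h1 => (hup ((one_lt_div hP).2 h1)).monotone,
    fun h1 => (hdown ((div_lt_one hP).2 h1)).antitone, ?_⟩
  filter_upwards [hS.isMarkovChain.ae_tendsto_comp_of_nonneg hS.p_nonneg hS.q_nonneg hharm
    fun j => (windowSum_pos hm hd j).le,
    hS.isMarkovChain.ae_abs_step_le_one, hS.ae_frequently_ne] with ω h1 h2 h3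
  obtain ⟨c, hc⟩ := h1
  exact ⟨⟨c, hc⟩, tendsto_atTop_or_atBot h2 (eventually_ne_of_tendsto h2 h3 hinj hc)⟩

theorem isTransientToPosInf_of_prod_lt [IsFiniteMeasure μ] (hm : 1 ≤ m)
    (hS : IsModRandomWalk μ m p q S)
    (h : ∏ i ∈ Finset.range m, q (i : ℤ) < ∏ i ∈ Finset.range m, p (i : ℤ)) :
    IsTransientToPosInf μ S := by
  obtain ⟨g, hpos, hper, -, hanti, hae⟩ := hS.ae_transient_of_prod_ne hm h.ne'
  have hP : 0 < ∏ i ∈ Finset.range m, p (i : ℤ) := Finset.prod_pos fun i _ => hS.p_pos i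
  have hQ : 0 < ∏ i ∈ Finset.range m, q (i : ℤ) := Finset.prod_pos fun i _ => hS.q_pos i
  -- Here `g` is antitone; after reflection it is monotone and grows by the inverse ratio over each
  -- period.
  have hblow : Tendsto (fun j => g (-j)) atTop atTop := by
    refine tendsto_atTop_of_period_mul (m := m) (fun a b hab => hanti h (neg_le_neg hab))
      ((one_lt_div hQ).2 h) (hpos _) fun j => ?_
    have := hper (-(j + m))
    rw [show -(j + (m : ℤ)) + m = -j by ring] at this
    rw [this]
    field_simp
  filter_upwards [hae] with ω ⟨⟨c, hc⟩, hω⟩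
  refine hω.resolve_right fun hbot => ?_
  have := hblow.comp (tendsto_neg_atBot_atTop.comp hbot)
  exact not_tendsto_nhds_of_tendsto_atTop this c (by simpa [Function.comp_def] using hc)

theorem isTransientToNegInf_of_prod_lt [IsFiniteMeasure μ] (hm : 1 ≤ m)
    (hS : IsModRandomWalk μ m p q S)
    (h : ∏ i ∈ Finset.range m, p (i : ℤ) < ∏ i ∈ Finset.range m, q (i : ℤ)) :
    IsTransientToNegInf μ S := by
  obtain ⟨g, hpos, hper, hmono, -, hae⟩ := hS.ae_transient_of_prod_ne hm h.ne
  have hP : 0 < ∏ i ∈ Finset.range m, p (i : ℤ) := Finset.prod_pos fun i _ => hS.p_pos i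
  have hblow : Tendsto g atTop atTop :=
    tendsto_atTop_of_period_mul (hmono h) ((one_lt_div hP).2 h) (hpos _) hper
  filter_upwards [hae] with ω ⟨⟨c, hc⟩, hω⟩
  exact hω.resolve_left fun htop => not_tendsto_nhds_of_tendsto_atTop (hblow.comp htop) c hc

end IsModRandomWalk

/-! ### Mutual exclusion and the trichotomy. -/

section Exclusive

variable {Ω : Type*} [MeasurableSpace Ω] {μ : Measure Ω} [NeZero μ] {S : ℕ → Ω → ℤ}

theorem IsRecurrent.not_isTransientToPosInf (h : IsRecurrent μ S) : ¬ IsTransientToPosInf μ S := by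
  intro h'
  obtain ⟨ω, h1, h2⟩ := (h.and h').exists
  exact h1 0 ((h2.eventually_gt_atTop 0).mono fun _ hn => hn.ne')

theorem IsRecurrent.not_isTransientToNegInf (h : IsRecurrent μ S) : ¬ IsTransientToNegInf μ S := by
  intro h'
  obtain ⟨ω, h1, h2⟩ := (h.and h').exists
  exact h1 0 ((h2.eventually_lt_atBot 0).mono fun _ hn => hn.ne)

theorem IsTransientToPosInf.not_isTransientToNegInf (h : IsTransientToPosInf μ S) :
    ¬ IsTransientToNegInf μ S := by
  intro h'
  obtain ⟨ω, h1, h2⟩ := (h.and h').exists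
  exact h1.not_tendsto disjoint_atTop_atBot h2

end Exclusive

theorem lemma3p1 {Ω : Type*} [MeasurableSpace Ω] (μ : Measure Ω) [IsProbabilityMeasure μ]
    (m : ℕ) (hm : 1 ≤ m) (p q : ℤ → ℝ) (S : ℕ → Ω → ℤ) (hS : IsModRandomWalk μ m p q S) :
    (IsRecurrent μ S ↔
      (∏ i ∈ Finset.range m, p (i : ℤ)) - (∏ i ∈ Finset.range m, q (i : ℤ)) = 0) ∧
    (IsTransientToPosInf μ S ↔
      0 < (∏ i ∈ Finset.range m, p (i : ℤ)) - (∏ i ∈ Finset.range m, q (i : ℤ))) ∧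
    (IsTransientToNegInf μ S ↔
      (∏ i ∈ Finset.range m, p (i : ℤ)) - (∏ i ∈ Finset.range m, q (i : ℤ)) < 0) := by
  rcases lt_trichotomy ((∏ i ∈ Finset.range m, p (i : ℤ)) - (∏ i ∈ Finset.range m, q (i : ℤ))) 0
    with h | h | h
  · have hN := hS.isTransientToNegInf_of_prod_lt hm (sub_neg.1 h)
    exact ⟨iff_of_false (fun h' => h'.not_isTransientToNegInf hN) h.ne,
      iff_of_false (fun h' => h'.not_isTransientToNegInf hN) h.le.not_gt, iff_of_true hN h⟩
  · have hR := hS.isRecurrent_of_prod_eq hm (sub_eq_zero.1 h)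
    exact ⟨iff_of_true hR h, iff_of_false hR.not_isTransientToPosInf h.le.not_gt,
      iff_of_false hR.not_isTransientToNegInf h.ge.not_gt⟩
  · have hT := hS.isTransientToPosInf_of_prod_lt hm (sub_pos.1 h)
    exact ⟨iff_of_false (fun h' => h'.not_isTransientToPosInf hT) h.ne',
      iff_of_true hT h, iff_of_false hT.not_isTransientToNegInf h.le.not_gt⟩
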